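/- Let $n\ge 0$ be an integer, let $a_1,\dots,a_n:\mathbb R\to\mathbb R$ be real analytic functions, and for $t\in\mathbb R$ let $$P(t)(x)=x^n-a_1(t)x^{n-1}+\dots+(-1)^n a_n(t).$$ Suppose that for every $t\in\mathbb R$ all complex roots of $P(t)$ are real. Then there are real analytic functions $x_1,\dots,x_n:\mathbb R\to\mathbb R$ such that, for every $t\in\mathbb R$, $x_1(t),\dots,x_n(t)$ are the roots of $P(t)$ counted with multiplicity, i.e. $P(t)(x)=\prod_{i=1}^n (x-x_i(t))$. Moreover, if $x_1,\dots,x_n$ and $y_1,\dots,y_n$ are two such systems of real analytic functions, then there is a permutation $\sigma$ of $\{1,\dots,n\}$, independent of $t$, such that $y_i(t)=x_{\sigma(i)}(t)$ for all $i$ and all $t\in\mathbb R$. -/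

import Mathlib

open Polynomial

/-- The curve of monic real polynomials
`P(t)(x) = x^n - a₁(t) x^(n-1) + ⋯ + (-1)^n aₙ(t)`.
Only the values `a i` with `1 ≤ i ≤ n` are used. -/
noncomputable def polyCurve (n : ℕ) (a : ℕ → ℝ → ℝ) (t : ℝ) : ℝ[X] :=
  X ^ n + ∑ i ∈ Finset.Icc 1 n, C ((-1) ^ i * a i t) * X ^ (n - i)

/-- All complex roots of the real polynomial `p` are real. -/
def AllRootsReal (p : ℝ[X]) : Prop :=
  ∀ z : ℂ, (p.map (algebraMap ℝ ℂ)).IsRoot z → z.im = 0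

/-- `x₁, …, xₙ` are real analytic on `ℝ` and, for every `t`, they are the roots of `P(t)`,
each listed according to its multiplicity. -/
structure IsAnalyticRootSystem {n : ℕ} (P : ℝ → ℝ[X]) (x : Fin n → ℝ → ℝ) : Prop where
  analytic : ∀ i, AnalyticOnNhd ℝ (x i) Set.univ
  factor : ∀ t, P t = ∏ i, (X - C (x i t))

open Filter Topology

/-! Locally, induct on the degree. If `P t₀` has two distinct roots, it splits into coprime monic
factors of lower degree. By the inverse function theorem (`AnalyticFamilyAt.exists_mul`) this
splitting extends analytically to nearby `t`.

To force distinct roots, translate so that the roots sum to zero. The sum `V` of their squares is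
then analytic and nonnegative. Either `V` vanishes near `t₀`, and so do all roots, or its order is
an even number `2m` and every root is `O(|t - t₀| ^ m)`. In the second case, dividing the roots by
`(t - t₀) ^ m` leaves the coefficients analytic and makes the new `V` nonzero at `t₀`, so the roots
there are not all equal (`hasAnalyticRootsAt_of_centered`). Real-rootedness gives both the sign of
`V` and the bound on the roots.

Globally, finitely many permutations and the identity theorem give uniqueness on intervals
(`IsAnalyticRootSystemOn.exists_perm`), which lets local systems be glued. -/

/-- The coefficients of the polynomials `P t` are analytic functions of `t` at `t₀`. -/
def AnalyticFamilyAt (P : ℝ → ℝ[X]) (t₀ : ℝ) : Prop :=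
  ∀ k, AnalyticAt ℝ (fun t => (P t).coeff k) t₀

/-! ### Coefficient coordinates on monic polynomials -/

/-- The polynomial of degree less than `m` with a given vector of coefficients. -/
noncomputable def lowPoly (m : ℕ) : (Fin m → ℝ) →ₗ[ℝ] ℝ[X] :=
  (degreeLT ℝ m).subtype ∘ₗ (degreeLTEquiv ℝ m).symm.toLinearMap

/-- The vector of the first `m` coefficients of a polynomial. -/
noncomputable def coeffVec (m : ℕ) : ℝ[X] →ₗ[ℝ] (Fin m → ℝ) :=
  LinearMap.pi fun i => lcoeff ℝ i

@[simp] lemma coeffVec_apply (m : ℕ) (p : ℝ[X]) (i : Fin m) : coeffVec m p i = p.coeff i := rfl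

lemma degree_lowPoly_lt (m : ℕ) (u : Fin m → ℝ) : (lowPoly m u).degree < m :=
  mem_degreeLT.1 ((degreeLTEquiv ℝ m).symm u).2

lemma lowPoly_coeffVec {m : ℕ} {p : ℝ[X]} (hp : p.degree < m) : lowPoly m (coeffVec m p) = p := by
  have h : coeffVec m p = degreeLTEquiv ℝ m ⟨p, mem_degreeLT.2 hp⟩ := rfl
  rw [h]
  simp [lowPoly]

lemma lowPoly_injective (m : ℕ) : Function.Injective (lowPoly m) :=
  Subtype.val_injective.comp (degreeLTEquiv ℝ m).symm.injective

lemma eq_zero_of_coeffVec_eq_zero {m : ℕ} {p : ℝ[X]} (hp : p.degree < m)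
    (h : coeffVec m p = 0) : p = 0 := by
  rw [← lowPoly_coeffVec hp, h, map_zero]

/-- The monic polynomial of degree `m` with given lower coefficients. -/
noncomputable def monicPoly (m : ℕ) (u : Fin m → ℝ) : ℝ[X] := X ^ m + lowPoly m u

lemma monic_monicPoly (m : ℕ) (u : Fin m → ℝ) : (monicPoly m u).Monic :=
  monic_X_pow_add (degree_lowPoly_lt m u)

lemma natDegree_monicPoly (m : ℕ) (u : Fin m → ℝ) : (monicPoly m u).natDegree = m := by
  apply natDegree_eq_of_degree_eq_some
  rw [monicPoly, degree_add_eq_left_of_degree_lt] <;> simp [degree_lowPoly_lt]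

lemma Polynomial.Monic.degree_sub_lt_of_natDegree {m : ℕ} {p q : ℝ[X]} (hp : p.Monic)
    (hq : q.Monic) (hpm : p.natDegree = m) (hqm : q.natDegree = m) : (p - q).degree < m := by
  rw [degree_lt_iff_coeff_zero]
  intro k hk
  rcases hk.eq_or_lt with rfl | hk
  · have h1 := hp.coeff_natDegree
    have h2 := hq.coeff_natDegree
    rw [hpm] at h1
    rw [hqm] at h2
    simp [h1, h2]
  · rw [coeff_sub, coeff_eq_zero_of_natDegree_lt (hpm ▸ hk),
      coeff_eq_zero_of_natDegree_lt (hqm ▸ hk), sub_zero]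

lemma Polynomial.Monic.eq_of_coeffVec_eq {m : ℕ} {p q : ℝ[X]} (hp : p.Monic) (hq : q.Monic)
    (hpm : p.natDegree = m) (hqm : q.natDegree = m) (h : coeffVec m p = coeffVec m q) :
    p = q :=
  sub_eq_zero.1 <| eq_zero_of_coeffVec_eq_zero (hp.degree_sub_lt_of_natDegree hq hpm hqm)
    (by rw [map_sub, h, sub_self])

lemma exists_eq_monicPoly {m : ℕ} {p : ℝ[X]} (hp : p.Monic) (hpm : p.natDegree = m) :
    ∃ u, p = monicPoly m u := by
  refine ⟨coeffVec m (p - X ^ m), ?_⟩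
  rw [monicPoly, lowPoly_coeffVec, add_sub_cancel]
  exact hp.degree_sub_lt_of_natDegree (monic_X_pow m) hpm (natDegree_X_pow m)

lemma analyticAt_coeff_monicPoly {E : Type*} [NormedAddCommGroup E] [NormedSpace ℝ E] {m : ℕ}
    {u : E → Fin m → ℝ} {z : E} (hu : AnalyticAt ℝ u z) (k : ℕ) :
    AnalyticAt ℝ (fun t => (monicPoly m (u t)).coeff k) z := by
  have h : (fun t => (monicPoly m (u t)).coeff k) =
      fun t => (X ^ m : ℝ[X]).coeff k +
        LinearMap.toContinuousLinearMap (lcoeff ℝ k ∘ₗ lowPoly m) (u t) := by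
    ext t
    simp [monicPoly]
  rw [h]
  exact analyticAt_const.add ((ContinuousLinearMap.analyticAt _ _).comp hu)

/-! ### Analytic splitting into coprime factors -/

/-- Multiplication of monic polynomials of degrees `p` and `q` in terms of coefficients. -/
noncomputable def mulMonic (p q : ℕ) (w : (Fin p → ℝ) × (Fin q → ℝ)) : Fin (p + q) → ℝ :=
  coeffVec (p + q) (monicPoly p w.1 * monicPoly q w.2)

lemma analyticAt_mulMonic (p q : ℕ) (w : (Fin p → ℝ) × (Fin q → ℝ)) :
    AnalyticAt ℝ (mulMonic p q) w := by
  rw [analyticAt_pi_iff]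
  intro i
  simp only [mulMonic, coeffVec_apply, coeff_mul]
  exact Finset.analyticAt_fun_sum _ fun x _ =>
    (analyticAt_coeff_monicPoly analyticAt_fst _).mul (analyticAt_coeff_monicPoly analyticAt_snd _)

/-- Along the line `w + s • d` the product is quadratic in `s`, and its linear coefficient is the
derivative. -/
lemma fderiv_mulMonic (p q : ℕ) (w d : (Fin p → ℝ) × (Fin q → ℝ)) :
    fderiv ℝ (mulMonic p q) w d =
      coeffVec (p + q) (lowPoly p d.1 * monicPoly q w.2 + monicPoly p w.1 * lowPoly q d.2) := by
  have h1 : HasDerivAt (fun s : ℝ => w + s • d) d 0 := by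
    simpa using ((hasDerivAt_id (0 : ℝ)).smul_const d).const_add w
  have h2 : HasFDerivAt (mulMonic p q) (fderiv ℝ (mulMonic p q) w) (w + (0 : ℝ) • d) := by
    simpa using (analyticAt_mulMonic p q w).differentiableAt.hasFDerivAt
  have h3 := h2.comp_hasDerivAt (0 : ℝ) h1
  refine h3.unique ?_
  set A := coeffVec (p + q) (monicPoly p w.1 * monicPoly q w.2)
  set B := coeffVec (p + q)
    (lowPoly p d.1 * monicPoly q w.2 + monicPoly p w.1 * lowPoly q d.2)
  set D := coeffVec (p + q) (lowPoly p d.1 * lowPoly q d.2)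
  have h4 : (mulMonic p q ∘ fun s : ℝ => w + s • d) = fun s => A + s • B + s ^ 2 • D := by
    ext1 s
    simp only [A, B, D, mulMonic, Function.comp, ← map_smul, ← map_add]
    congr 1
    simp only [monicPoly, Prod.fst_add, Prod.snd_add, Prod.smul_fst, Prod.smul_snd, map_add,
      map_smul, smul_eq_C_mul, C_pow]
    ring
  rw [h4]
  have h5 := (((hasDerivAt_id (0 : ℝ)).smul_const B).const_add A).add
    (((hasDerivAt_id (0 : ℝ)).pow 2).smul_const D)
  refine (h5.congr_deriv ?_).congr_of_eventuallyEq (Eventually.of_forall fun s => ?_) <;> simp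

/-- If `a * g + f * b = 0` with `f`, `g` coprime, then `f` divides `a`, which has smaller degree; so
`a = 0`, and then `b = 0`. -/
lemma fderiv_mulMonic_injective {p q : ℕ} {w : (Fin p → ℝ) × (Fin q → ℝ)}
    (h : IsCoprime (monicPoly p w.1) (monicPoly q w.2)) :
    Function.Injective (fderiv ℝ (mulMonic p q) w) := by
  rw [injective_iff_map_eq_zero]
  intro d hd
  have degp : (monicPoly p w.1).degree = p := by
    rw [degree_eq_natDegree (monic_monicPoly _ _).ne_zero, natDegree_monicPoly]
  have degq : (monicPoly q w.2).degree = q := by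
    rw [degree_eq_natDegree (monic_monicPoly _ _).ne_zero, natDegree_monicPoly]
  rw [fderiv_mulMonic] at hd
  have hz := eq_zero_of_coeffVec_eq_zero (m := p + q) (by
    refine (degree_add_le _ _).trans_lt (max_lt ?_ ?_)
    · rw [degree_mul, degq, Nat.cast_add]
      exact WithBot.add_lt_add_right (by simp) (degree_lowPoly_lt _ _)
    · rw [degree_mul, degp, Nat.cast_add]
      exact WithBot.add_lt_add_left (by simp) (degree_lowPoly_lt _ _)) hd
  have h1 : lowPoly p d.1 = 0 := by
    refine eq_zero_of_dvd_of_degree_lt (h.dvd_of_dvd_mul_right ?_)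
      (degp ▸ degree_lowPoly_lt _ _ : _ < _)
    exact ⟨-lowPoly q d.2, by linear_combination hz⟩
  have h2 : lowPoly q d.2 = 0 := by
    rw [h1, zero_mul, zero_add] at hz
    exact (mul_eq_zero.1 hz).resolve_left (monic_monicPoly _ _).ne_zero
  exact Prod.ext (lowPoly_injective p (h1.trans (map_zero _).symm))
    (lowPoly_injective q (h2.trans (map_zero _).symm))

lemma coeff_monicPoly {m : ℕ} (u : Fin m → ℝ) (i : Fin m) : (monicPoly m u).coeff i = u i := by
  have h : coeffVec m (lowPoly m u) = u :=
    (degreeLTEquiv ℝ m).apply_symm_apply u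
  have h1 : (lowPoly m u).coeff i = u i := congrFun h i
  rw [monicPoly, coeff_add, h1, coeff_X_pow, if_neg i.2.ne, zero_add]

/-- A factorization into coprime monic factors at `t₀` extends to a factorization of the
analytic family of monic polynomials near `t₀`. -/
theorem AnalyticFamilyAt.exists_mul {P : ℝ → ℝ[X]} {t₀ : ℝ} (hP : AnalyticFamilyAt P t₀)
    {p q : ℕ} (hmon : ∀ᶠ t in 𝓝 t₀, (P t).Monic ∧ (P t).natDegree = p + q) {f g : ℝ[X]}
    (hf : f.Monic) (hg : g.Monic) (hfp : f.natDegree = p) (hgq : g.natDegree = q)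
    (hfg : IsCoprime f g) (h₀ : P t₀ = f * g) :
    ∃ F G : ℝ → ℝ[X], AnalyticFamilyAt F t₀ ∧ AnalyticFamilyAt G t₀ ∧
      (∀ t, (F t).Monic ∧ (F t).natDegree = p) ∧ (∀ t, (G t).Monic ∧ (G t).natDegree = q) ∧
      ∀ᶠ t in 𝓝 t₀, P t = F t * G t := by
  obtain ⟨u, rfl⟩ := exists_eq_monicPoly hf hfp
  obtain ⟨v, rfl⟩ := exists_eq_monicPoly hg hgq
  have hinj := fderiv_mulMonic_injective (w := (u, v)) hfg
  -- The exponent `⊤` means analytic, so the local inverse is analytic and not merely smooth.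
  have hcd : ContDiffAt ℝ ⊤ (mulMonic p q) (u, v) := (analyticAt_mulMonic p q (u, v)).contDiffAt
  let e : ((Fin p → ℝ) × (Fin q → ℝ)) ≃L[ℝ] (Fin (p + q) → ℝ) :=
    (LinearEquiv.ofInjectiveOfFinrankEq (fderiv ℝ (mulMonic p q) (u, v)).toLinearMap hinj
      (by simp)).toContinuousLinearEquiv
  have hder : HasFDerivAt (mulMonic p q)
      (e : ((Fin p → ℝ) × (Fin q → ℝ)) →L[ℝ] (Fin (p + q) → ℝ)) (u, v) := by
    have he : (e : ((Fin p → ℝ) × (Fin q → ℝ)) →L[ℝ] (Fin (p + q) → ℝ)) =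
        fderiv ℝ (mulMonic p q) (u, v) := 
      ContinuousLinearMap.ext fun _ => rfl
    rw [he]
    exact (analyticAt_mulMonic p q (u, v)).differentiableAt.hasFDerivAt
  set φ := hcd.localInverse hder (by simp)
  have hφ : AnalyticAt ℝ φ (mulMonic p q (u, v)) :=
    (hcd.to_localInverse hder (by simp)).analyticAt
  have hinv : ∀ᶠ y in 𝓝 (mulMonic p q (u, v)), mulMonic p q (φ y) = y :=
    (hcd.hasStrictFDerivAt' hder (by simp)).eventually_right_inverse
  have hPt : coeffVec (p + q) (P t₀) = mulMonic p q (u, v) := by rw [h₀]; rfl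
  have hPa : AnalyticAt ℝ (fun t => coeffVec (p + q) (P t)) t₀ :=
    analyticAt_pi_iff.2 fun i => hP i
  rw [← hPt] at hφ hinv
  have hψ : AnalyticAt ℝ (fun t => φ (coeffVec (p + q) (P t))) t₀ :=
    AnalyticAt.fun_comp (f := fun t => coeffVec (p + q) (P t)) hφ hPa
  refine ⟨fun t => monicPoly p (φ (coeffVec (p + q) (P t))).1,
    fun t => monicPoly q (φ (coeffVec (p + q) (P t))).2,
    analyticAt_coeff_monicPoly (analyticAt_fst.fun_comp hψ),
    analyticAt_coeff_monicPoly (analyticAt_snd.fun_comp hψ),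
    fun t => ⟨monic_monicPoly _ _, natDegree_monicPoly _ _⟩,
    fun t => ⟨monic_monicPoly _ _, natDegree_monicPoly _ _⟩, ?_⟩
  filter_upwards [hmon, hPa.continuousAt.eventually hinv] with t ht h
  refine ht.1.eq_of_coeffVec_eq ((monic_monicPoly _ _).mul (monic_monicPoly _ _)) ht.2 ?_ h.symm
  rw [(monic_monicPoly _ _).natDegree_mul (monic_monicPoly _ _), natDegree_monicPoly,
    natDegree_monicPoly]

/-! ### Real-rooted polynomials -/

lemma allRootsReal_iff_aeval {p : ℝ[X]} :
    AllRootsReal p ↔ ∀ z : ℂ, aeval z p = 0 → z.im = 0 := by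
  simp only [AllRootsReal, IsRoot.def, eval_map_algebraMap]

lemma AllRootsReal.of_dvd {p q : ℝ[X]} (hq : AllRootsReal q) (h : p ∣ q) : AllRootsReal p := by
  intro z hz
  exact hq z (IsRoot.dvd hz (Polynomial.map_dvd (algebraMap ℝ ℂ) h))

lemma AllRootsReal.splits {p : ℝ[X]} (hp : AllRootsReal p) : p.Splits := by
  refine Splits.of_splits_map (algebraMap ℝ ℂ) (IsAlgClosed.splits _) fun z hz => ?_
  have h := hp z (isRoot_of_mem_roots hz)
  exact ⟨z.re, Complex.ext (by simp) (by simp [h])⟩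

lemma AllRootsReal.taylor {p : ℝ[X]} (hp : AllRootsReal p) (c : ℝ) :
    AllRootsReal (taylor c p) := by
  rw [allRootsReal_iff_aeval] at *
  intro z hz
  have := hp (z + c) (by simpa [taylor_apply, aeval_comp] using hz)
  simpa using this

lemma AllRootsReal.of_scaleRoots {p : ℝ[X]} {s : ℝ} (hs : s ≠ 0)
    (hp : AllRootsReal (p.scaleRoots s)) : AllRootsReal p := by
  rw [allRootsReal_iff_aeval] at *
  intro z hz
  have := hp _ (scaleRoots_aeval_eq_zero (r := s) hz)
  simpa [hs] using this

/-- Each factor `z - a` with `a` real has norm at least `|z.im|`. The estimate passes to limits, so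
real-rootedness is a closed condition. -/
lemma AllRootsReal.abs_im_pow_le {p : ℝ[X]} (hp : AllRootsReal p) (hm : p.Monic) (z : ℂ) :
    |z.im| ^ p.natDegree ≤ ‖aeval z p‖ := by
  have h1 := hp.splits.eq_prod_roots_of_monic hm
  have h2 := splits_iff_card_roots.1 hp.splits
  rw [← h2]
  conv_rhs => rw [h1]
  generalize p.roots = s
  induction s using Multiset.induction with
  | empty => simp
  | cons a s ih =>
    rw [Multiset.map_cons, Multiset.prod_cons, map_mul, norm_mul, Multiset.card_cons, pow_succ']
    gcongr
    simpa using Complex.abs_im_le_norm (z - a)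

lemma continuousAt_aeval {P : ℝ → ℝ[X]} {t₀ : ℝ} {n : ℕ} (hP : AnalyticFamilyAt P t₀)
    (hn : ∀ t, (P t).natDegree = n) (z : ℂ) : ContinuousAt (fun t => aeval z (P t)) t₀ := by
  have h : (fun t => aeval z (P t)) =
      fun t => ∑ i ∈ Finset.range (n + 1), (P t).coeff i • z ^ i := by
    ext1 t
    rw [aeval_eq_sum_range, hn]
  rw [h]
  exact tendsto_finsetSum _ fun i _ => (hP i).continuousAt.smul continuousAt_const

lemma allRootsReal_of_eventually {P : ℝ → ℝ[X]} {t₀ : ℝ} {n : ℕ} (hP : AnalyticFamilyAt P t₀)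
    (hn : ∀ t, (P t).Monic ∧ (P t).natDegree = n)
    (hr : ∀ᶠ t in 𝓝[≠] t₀, AllRootsReal (P t)) : AllRootsReal (P t₀) := by
  rw [allRootsReal_iff_aeval]
  intro z hz
  have hc := (continuousAt_aeval hP (fun t => (hn t).2) z).norm.tendsto.mono_left
    (nhdsWithin_le_nhds (s := {t₀}ᶜ))
  have h : |z.im| ^ n ≤ ‖aeval z (P t₀)‖ := by
    refine ge_of_tendsto hc ?_
    filter_upwards [hr] with t ht
    rw [← (hn t).2]
    exact ht.abs_im_pow_le (hn t).1 z
  rw [hz, norm_zero] at h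
  exact abs_eq_zero.1 (eq_zero_of_pow_eq_zero (le_antisymm h (by positivity)))

lemma AnalyticFamilyAt.taylor {P : ℝ → ℝ[X]} {t₀ : ℝ} {n : ℕ} (hP : AnalyticFamilyAt P t₀)
    (hn : ∀ t, (P t).natDegree = n) {c : ℝ → ℝ} (hc : AnalyticAt ℝ c t₀) :
    AnalyticFamilyAt (fun t => taylor (c t) (P t)) t₀ := by
  intro k
  have h : (fun t => (Polynomial.taylor (c t) (P t)).coeff k) = fun t =>
      ∑ i ∈ Finset.range (n + 1), ((i + k).choose k * (P t).coeff (i + k)) * c t ^ i := by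
    ext1 t
    rw [taylor_coeff, eval_eq_sum_range' (n := n + 1)]
    · simp only [hasseDeriv_coeff]
    · have := natDegree_hasseDeriv_le (P t) k
      have := hn t
      omega
  rw [h]
  exact Finset.analyticAt_fun_sum _ fun i _ =>
    (analyticAt_const.mul (hP (i + k))).mul (hc.pow i)

/-! ### Power sums of the roots and coefficient bounds -/

section Multiset

variable (s : Multiset ℝ)

lemma coeff_card_prod_X_sub_C : (s.map (X - C ·)).prod.coeff s.card = 1 := by
  have h := (monic_multisetProd_X_sub_C s).coeff_natDegree
  rwa [natDegree_multiset_prod_X_sub_C_eq_card] at h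

/-- The factor `X` (below, `X ^ 2`) shifts indices so that the induction needs no lower bound on the
cardinality. -/
lemma coeff_card_X_mul_prod_X_sub_C :
    (X * (s.map (X - C ·)).prod).coeff s.card = -s.sum := by
  induction s using Multiset.induction with
  | empty => simp
  | cons a s ih =>
    rw [Multiset.map_cons, Multiset.prod_cons, Multiset.card_cons, Multiset.sum_cons,
      coeff_X_mul, sub_mul, coeff_sub, ih, coeff_C_mul, coeff_card_prod_X_sub_C]
    ring

lemma coeff_card_X_sq_mul_prod_X_sub_C :
    2 * (X ^ 2 * (s.map (X - C ·)).prod).coeff s.card = s.sum ^ 2 - (s.map (· ^ 2)).sum := by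
  induction s using Multiset.induction with
  | empty => simp
  | cons a s ih =>
    have h : X ^ 2 * ((X - C a) * (s.map (X - C ·)).prod) =
      X * (X ^ 2 * (s.map (X - C ·)).prod - C a * (X * (s.map (X - C ·)).prod)) := by ring
    rw [Multiset.map_cons, Multiset.prod_cons, Multiset.card_cons, Multiset.sum_cons,
      Multiset.map_cons, Multiset.sum_cons, h, coeff_X_mul, coeff_sub, coeff_C_mul, mul_sub, ih,
      coeff_card_X_mul_prod_X_sub_C]
    ring

lemma sum_sq_eq_coeff {k : ℕ} (hk : s.card = k + 2) :
    (s.map (· ^ 2)).sum = s.sum ^ 2 - 2 * (s.map (X - C ·)).prod.coeff k := by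
  have h := coeff_card_X_sq_mul_prod_X_sub_C s
  rw [hk, coeff_X_pow_mul] at h
  linarith

lemma sum_eq_neg_coeff {k : ℕ} (hk : s.card = k + 1) :
    s.sum = -(s.map (X - C ·)).prod.coeff k := by
  have h := coeff_card_X_mul_prod_X_sub_C s
  rw [hk, coeff_X_mul] at h
  linarith

lemma taylor_multiset_prod (c : ℝ) :
    taylor c (s.map (X - C ·)).prod = ((s.map (· - c)).map (X - C ·)).prod := by
  induction s using Multiset.induction with
  | empty => simp
  | cons a s ih =>
    simp only [Multiset.map_cons, Multiset.prod_cons, taylor_mul, ih]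
    congr 1
    simp [taylor_apply]
    ring

end Multiset

lemma Polynomial.Splits.coeff_taylor {p : ℝ[X]} (hs : p.Splits) (hm : p.Monic) {k : ℕ}
    (hk : p.natDegree = k + 1) (c : ℝ) :
    (Polynomial.taylor c p).coeff k = p.coeff k + (k + 1) * c := by
  have h1 := hs.eq_prod_roots_of_monic hm
  have h2 := splits_iff_card_roots.1 hs
  rw [hk] at h2
  generalize p.roots = s at *
  have h3 := sum_eq_neg_coeff s h2
  have h4 := sum_eq_neg_coeff (s.map (· - c)) (by simpa using h2)
  rw [← taylor_multiset_prod, ← h1] at h4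
  rw [← h1] at h3
  simp [h2] at h4
  linarith

lemma Polynomial.Splits.sum_sq_roots {p : ℝ[X]} (hs : p.Splits) (hm : p.Monic) {k : ℕ}
    (hk : p.natDegree = k + 2) (h0 : p.coeff (k + 1) = 0) :
    (p.roots.map (· ^ 2)).sum = -2 * p.coeff k := by
  have h1 := hs.eq_prod_roots_of_monic hm
  have h2 := splits_iff_card_roots.1 hs
  rw [hk] at h2
  generalize p.roots = s at *
  have h3 := sum_eq_neg_coeff s h2
  have h4 := sum_sq_eq_coeff s h2
  rw [← h1] at h3 h4
  rw [h4, h3, h0]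
  ring

lemma Polynomial.Splits.coeff_le_zero {p : ℝ[X]} (hs : p.Splits) (hm : p.Monic) {k : ℕ}
    (hk : p.natDegree = k + 2) (h0 : p.coeff (k + 1) = 0) : p.coeff k ≤ 0 := by
  have h := hs.sum_sq_roots hm hk h0
  have : 0 ≤ (p.roots.map (· ^ 2)).sum := Multiset.sum_nonneg fun x hx => by
    obtain ⟨y, -, rfl⟩ := Multiset.mem_map.1 hx
    positivity
  linarith

lemma Polynomial.Splits.sq_root_le {p : ℝ[X]} (hs : p.Splits) (hm : p.Monic) {k : ℕ}
    (hk : p.natDegree = k + 2) (h0 : p.coeff (k + 1) = 0) {r : ℝ} (hr : r ∈ p.roots) :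
    r ^ 2 ≤ -2 * p.coeff k := by
  rw [← hs.sum_sq_roots hm hk h0]
  refine Multiset.single_le_sum (fun x hx => ?_) _ (Multiset.mem_map_of_mem _ hr)
  obtain ⟨y, -, rfl⟩ := Multiset.mem_map.1 hx
  positivity

lemma Polynomial.Splits.abs_coeff_le {p : ℝ[X]} (hs : p.Splits) (hm : p.Monic) {k : ℕ}
    (hk : p.natDegree = k + 2) (h0 : p.coeff (k + 1) = 0) {B : ℝ} (hB : 0 ≤ B)
    (h : -2 * p.coeff k ≤ B ^ 2) (j : ℕ) :
    |p.coeff j| ≤ B ^ (k + 2 - j) * (k + 2).choose j := by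
  have := coeff_le_of_roots_le (f := RingHom.id ℝ) (p := p) (B := B) j hm (by simpa using hs)
    (fun z hz => by
      rw [map_id] at hz
      exact abs_le_of_sq_le_sq ((hs.sq_root_le hm hk h0 hz).trans h) hB)
  simpa [hk] using this

/-- Zero root sum forces `r = 0`. Hence a centred polynomial with nonzero coefficient `k` has
distinct roots. -/
lemma X_sub_C_pow_eq_of_coeff_eq_zero {k : ℕ} {r : ℝ}
    (h : ((X - C r) ^ (k + 2)).coeff (k + 1) = 0) : ((X - C r) ^ (k + 2)).coeff k = 0 := by
  have h1 := sum_eq_neg_coeff (Multiset.replicate (k + 2) r) (k := k + 1) (by simp)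
  have h2 := sum_sq_eq_coeff (Multiset.replicate (k + 2) r) (k := k) (by simp)
  simp only [Multiset.map_replicate, Multiset.prod_replicate, Multiset.sum_replicate, h] at h1 h2
  have hr : r = 0 := by
    have h3 : ((k + 2 : ℕ) : ℝ) ≠ 0 := by positivity
    simpa [h3, -Nat.cast_add] using h1
  subst hr
  simp at h2 ⊢

/-! ### Orders of vanishing -/

lemma AnalyticAt.exists_eq_pow_mul_of_abs_le {f : ℝ → ℝ} {t₀ C : ℝ} {k : ℕ}
    (hf : AnalyticAt ℝ f t₀) (h : ∀ᶠ t in 𝓝 t₀, |f t| ≤ C * |t - t₀| ^ k) :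
    ∃ g : ℝ → ℝ, AnalyticAt ℝ g t₀ ∧ ∀ᶠ t in 𝓝 t₀, f t = (t - t₀) ^ k * g t := by
  suffices hk : (k : ℕ∞) ≤ analyticOrderAt f t₀ by
    simpa using (natCast_le_analyticOrderAt hf).1 hk
  by_contra! hlt
  obtain ⟨l, hl⟩ := ENat.ne_top_iff_exists.1 hlt.ne_top
  rw [← hl, Nat.cast_lt] at hlt
  obtain ⟨g, hg, hg0, hfg⟩ := hf.analyticOrderAt_eq_natCast.1 hl.symm
  apply hg0
  have h1 : Tendsto (fun t => C * |t - t₀| ^ (k - l)) (𝓝[≠] t₀) (𝓝 0) := by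
    have : ContinuousAt (fun t => C * |t - t₀| ^ (k - l)) t₀ := by fun_prop
    have h := this.tendsto.mono_left (nhdsWithin_le_nhds (s := {t₀}ᶜ))
    simpa [Nat.sub_ne_zero_of_lt hlt] using h
  have h2 : |g t₀| ≤ 0 := by
    refine le_of_tendsto_of_tendsto
      (hg.continuousAt.abs.tendsto.mono_left (nhdsWithin_le_nhds (s := {t₀}ᶜ))) h1 ?_
    filter_upwards [nhdsWithin_le_nhds h, nhdsWithin_le_nhds hfg, self_mem_nhdsWithin]
      with t ht hft hne
    have hpos : 0 < |t - t₀| ^ l := by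
      have : 0 < |t - t₀| := abs_pos.2 (sub_ne_zero.2 hne)
      positivity
    rw [hft, smul_eq_mul, abs_mul, abs_pow] at ht
    refine le_of_mul_le_mul_left (ht.trans_eq ?_) hpos
    rw [← pow_mul_pow_sub _ hlt.le]
    ring
  exact abs_eq_zero.1 (le_antisymm h2 (abs_nonneg _))

/-- For odd `N` the power changes sign at `t₀` while `g` does not. -/
lemma even_order_of_nonneg {f g : ℝ → ℝ} {t₀ : ℝ} {N : ℕ} (hg : ContinuousAt g t₀)
    (hg0 : g t₀ ≠ 0) (hfg : ∀ᶠ t in 𝓝 t₀, f t = (t - t₀) ^ N * g t)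
    (hf : ∀ᶠ t in 𝓝 t₀, 0 ≤ f t) : Even N := by
  by_contra hN
  rw [Nat.not_even_iff_odd] at hN
  have hall := hf.and hfg
  rcases lt_or_gt_of_ne hg0 with h | h
  · have h1 := (hall.and (hg.eventually_lt_const h)).filter_mono (nhdsWithin_le_nhds (s := Set.Ioi t₀))
    obtain ⟨t, ⟨⟨h2, h3⟩, h4⟩, h5⟩ := (h1.and self_mem_nhdsWithin).exists
    have : 0 < (t - t₀) ^ N := pow_pos (sub_pos.2 h5) N
    nlinarith
  · have h1 := (hall.and (hg.eventually_const_lt h)).filter_mono (nhdsWithin_le_nhds (s := Set.Iio t₀))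
    obtain ⟨t, ⟨⟨h2, h3⟩, h4⟩, h5⟩ := (h1.and self_mem_nhdsWithin).exists
    have : (t - t₀) ^ N < 0 := hN.pow_neg (sub_neg.2 h5)
    nlinarith

lemma eq_of_eventually_pow_mul_eq {f g : ℝ → ℝ} {t₀ : ℝ} {k : ℕ} (hf : ContinuousAt f t₀)
    (hg : ContinuousAt g t₀)
    (h : ∀ᶠ t in 𝓝 t₀, (t - t₀) ^ k * f t = (t - t₀) ^ k * g t) : f t₀ = g t₀ := by
  refine tendsto_nhds_unique_of_eventuallyEq
    (hf.tendsto.mono_left (nhdsWithin_le_nhds (s := {t₀}ᶜ)))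
    (hg.tendsto.mono_left nhdsWithin_le_nhds) ?_
  filter_upwards [nhdsWithin_le_nhds h, self_mem_nhdsWithin] with t ht hne
  exact mul_left_cancel₀ (pow_ne_zero k (sub_ne_zero.2 hne)) ht

/-! ### The local theorem -/

/-- Near `t₀`, the roots of `P t` are given by `n` analytic functions. -/
def HasAnalyticRootsAt (n : ℕ) (P : ℝ → ℝ[X]) (t₀ : ℝ) : Prop :=
  ∃ x : Fin n → ℝ → ℝ, (∀ i, AnalyticAt ℝ (x i) t₀) ∧ ∀ᶠ t in 𝓝 t₀, P t = ∏ i, (X - C (x i t))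

lemma HasAnalyticRootsAt.congr {n : ℕ} {P Q : ℝ → ℝ[X]} {t₀ : ℝ}
    (hP : HasAnalyticRootsAt n P t₀) (h : ∀ᶠ t in 𝓝 t₀, Q t = P t) :
    HasAnalyticRootsAt n Q t₀ := by
  obtain ⟨x, hx, hPx⟩ := hP
  exact ⟨x, hx, by filter_upwards [h, hPx] with t h1 h2 using h1.trans h2⟩

lemma HasAnalyticRootsAt.mul {p q : ℕ} {F G : ℝ → ℝ[X]} {t₀ : ℝ}
    (hF : HasAnalyticRootsAt p F t₀) (hG : HasAnalyticRootsAt q G t₀) :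
    HasAnalyticRootsAt (p + q) (fun t => F t * G t) t₀ := by
  obtain ⟨x, hx, hFx⟩ := hF
  obtain ⟨y, hy, hGy⟩ := hG
  refine ⟨Fin.append x y, fun i => ?_, ?_⟩
  · refine Fin.addCases (fun i => ?_) (fun i => ?_) i
    · simpa using hx i
    · simpa using hy i
  · filter_upwards [hFx, hGy] with t h1 h2
    simp [Fin.prod_univ_add, h1, h2]

lemma HasAnalyticRootsAt.of_taylor {n : ℕ} {P : ℝ → ℝ[X]} {t₀ : ℝ} {c : ℝ → ℝ}
    (hc : AnalyticAt ℝ c t₀) (h : HasAnalyticRootsAt n (fun t => taylor (c t) (P t)) t₀) :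
    HasAnalyticRootsAt n P t₀ := by
  obtain ⟨x, hx, hPx⟩ := h
  refine ⟨fun i t => x i t + c t, fun i => (hx i).add hc, ?_⟩
  filter_upwards [hPx] with t ht
  apply taylor_injective (c t)
  rw [ht, ← taylorAlgHom_apply, map_prod]
  refine Finset.prod_congr rfl fun i _ => ?_
  simp [taylor_apply]

lemma scaleRoots_prod_X_sub_C {ι : Type*} (u : Finset ι) (x : ι → ℝ) (s : ℝ) :
    (∏ i ∈ u, (X - C (x i))).scaleRoots s = ∏ i ∈ u, (X - C (s * x i)) := by
  classical
  induction u using Finset.induction with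
  | empty => simp
  | insert i u hi ih =>
    rw [Finset.prod_insert hi, Finset.prod_insert hi, mul_scaleRoots_of_noZeroDivisors, ih,
      X_sub_C_scaleRoots, mul_comm (x i)]

lemma HasAnalyticRootsAt.scaleRoots {n : ℕ} {P : ℝ → ℝ[X]} {t₀ : ℝ} {c : ℝ → ℝ}
    (hc : AnalyticAt ℝ c t₀) (h : HasAnalyticRootsAt n P t₀) :
    HasAnalyticRootsAt n (fun t => (P t).scaleRoots (c t)) t₀ := by
  obtain ⟨x, hx, hPx⟩ := h
  refine ⟨fun i t => c t * x i t, fun i => hc.mul (hx i), ?_⟩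
  filter_upwards [hPx] with t ht
  rw [ht, scaleRoots_prod_X_sub_C]

/-- All families of monic real-rooted polynomials of degree `n` have analytic roots at `t₀`. -/
def AnalyticRootsInDegree (n : ℕ) (t₀ : ℝ) : Prop :=
  ∀ P : ℝ → ℝ[X], AnalyticFamilyAt P t₀ → (∀ t, (P t).Monic ∧ (P t).natDegree = n) →
    (∀ᶠ t in 𝓝 t₀, AllRootsReal (P t)) → HasAnalyticRootsAt n P t₀

/-- Split off the full power of one root; the cofactor no longer vanishes there. -/
lemma exists_coprime_factorization {p : ℝ[X]} (hm : p.Monic) (hs : p.Splits)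
    (hd : p.natDegree ≠ 0) (hne : ∀ r, p ≠ (X - C r) ^ p.natDegree) :
    ∃ f g : ℝ[X], f.Monic ∧ g.Monic ∧ f.natDegree < p.natDegree ∧ g.natDegree < p.natDegree ∧
      f.natDegree + g.natDegree = p.natDegree ∧ IsCoprime f g ∧ p = f * g := by
  obtain ⟨r, hr⟩ := hs.exists_eval_eq_zero
    (by rw [degree_eq_natDegree hm.ne_zero]; exact_mod_cast hd)
  obtain ⟨g, hg, hndvd⟩ := exists_eq_pow_rootMultiplicity_mul_and_not_dvd p hm.ne_zero r
  have hk : 0 < rootMultiplicity r p := (rootMultiplicity_pos hm.ne_zero).2 hr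
  set k := rootMultiplicity r p
  have hfm : ((X - C r) ^ k).Monic := (monic_X_sub_C r).pow k
  have hgm : g.Monic := hfm.of_mul_monic_left (hg ▸ hm)
  have hfd : ((X - C r) ^ k).natDegree = k := by simp
  have hdeg : p.natDegree = k + g.natDegree := by
    conv_lhs => rw [hg, hfm.natDegree_mul hgm, hfd]
  have hg0 : g.natDegree ≠ 0 := by
    intro h0
    apply hne r
    rw [hdeg, h0, add_zero]
    rwa [hgm.natDegree_eq_zero.1 h0, mul_one] at hg
  exact ⟨(X - C r) ^ k, g, hfm, hgm, by omega, by omega, by omega,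
    (((irreducible_X_sub_C r).coprime_iff_not_dvd).2 hndvd).pow_left, hg⟩

lemma hasAnalyticRootsAt_of_not_pow {n : ℕ} {t₀ : ℝ}
    (ih : ∀ m < n, AnalyticRootsInDegree m t₀) {P : ℝ → ℝ[X]} (hP : AnalyticFamilyAt P t₀)
    (hn : ∀ t, (P t).Monic ∧ (P t).natDegree = n) (hr : ∀ᶠ t in 𝓝 t₀, AllRootsReal (P t))
    (hn0 : n ≠ 0) (hne : ∀ r, P t₀ ≠ (X - C r) ^ n) : HasAnalyticRootsAt n P t₀ := by
  have hd := (hn t₀).2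
  obtain ⟨f, g, hf, hg, hfn, hgn, hfg, hcop, hmul⟩ := exists_coprime_factorization (hn t₀).1
    hr.self_of_nhds.splits (by rwa [hd]) (by rwa [hd])
  rw [hd] at hfn hgn hfg
  obtain ⟨F, G, hF, hG, hFm, hGm, hPFG⟩ := hP.exists_mul
    (Eventually.of_forall fun t => ⟨(hn t).1, (hn t).2.trans hfg.symm⟩) hf hg rfl rfl hcop hmul
  have h1 := ih _ hfn F hF hFm (by
    filter_upwards [hr, hPFG] with t h1 h2
    exact h1.of_dvd ⟨_, h2⟩)
  have h2 := ih _ hgn G hG hGm (by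
    filter_upwards [hr, hPFG] with t h1 h2
    exact h1.of_dvd ⟨_, h2.trans (mul_comm _ _)⟩)
  rw [← hfg]
  exact (h1.mul h2).congr hPFG

lemma hasAnalyticRootsAt_of_centered {k : ℕ} {t₀ : ℝ}
    (ih : ∀ m < k + 2, AnalyticRootsInDegree m t₀) {Q : ℝ → ℝ[X]} (hQ : AnalyticFamilyAt Q t₀)
    (hn : ∀ t, (Q t).Monic ∧ (Q t).natDegree = k + 2)
    (hr : ∀ᶠ t in 𝓝 t₀, AllRootsReal (Q t)) (h0 : ∀ᶠ t in 𝓝 t₀, (Q t).coeff (k + 1) = 0) :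
    HasAnalyticRootsAt (k + 2) Q t₀ := by
  set V : ℝ → ℝ := fun t => -2 * (Q t).coeff k
  have hV : AnalyticAt ℝ V t₀ := analyticAt_const.mul (hQ k)
  rcases eq_or_ne (analyticOrderAt V t₀) ⊤ with htop | htop
  · rw [analyticOrderAt_eq_top] at htop
    refine ⟨fun _ _ => 0, fun _ => analyticAt_const, ?_⟩
    filter_upwards [htop, hr, h0] with t hVt hrt h0t
    have hs := hrt.splits
    have hroots : (Q t).roots = Multiset.replicate (k + 2) 0 := by
      refine Multiset.eq_replicate.2 ⟨?_, fun b hb => ?_⟩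
      · rw [splits_iff_card_roots.1 hs, (hn t).2]
      · have := hs.sq_root_le (hn t).1 (hn t).2 h0t hb
        exact eq_zero_of_pow_eq_zero (le_antisymm (this.trans_eq hVt) (sq_nonneg b))
    rw [hs.eq_prod_roots_of_monic (hn t).1, hroots]
    simp [pow_succ']
  obtain ⟨N, hN⟩ := ENat.ne_top_iff_exists.1 htop
  obtain ⟨g, hg, hg0, hVg⟩ := hV.analyticOrderAt_eq_natCast.1 hN.symm
  simp only [smul_eq_mul] at hVg
  obtain ⟨m, hm⟩ : Even N := by
    refine even_order_of_nonneg hg.continuousAt hg0 hVg ?_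
    filter_upwards [hr, h0] with t hrt h0t
    have := hrt.splits.coeff_le_zero (hn t).1 (hn t).2 h0t
    simp only [V]
    linarith
  -- Since `M ^ 2 > |g t₀|`, the sum of squares, and hence each squared root, is at most `(M * |t -
  -- t₀| ^ m) ^ 2` near `t₀`.
  set M := √(|g t₀| + 1)
  have hM : 0 ≤ M := Real.sqrt_nonneg _
  have hVM : ∀ᶠ t in 𝓝 t₀, V t ≤ (M * |t - t₀| ^ m) ^ 2 := by
    have hlt : |g t₀| < |g t₀| + 1 := by linarith
    filter_upwards [hVg, hg.continuousAt.abs.eventually_lt_const hlt] with t h1 h2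
    rw [h1, mul_pow, Real.sq_sqrt (by positivity), ← pow_mul, mul_comm m 2, pow_mul, sq_abs, hm,
      ← two_mul, pow_mul, mul_comm]
    gcongr
    exact (le_abs_self _).trans h2.le
  have hd : ∀ j : Fin (k + 2), ∃ d : ℝ → ℝ, AnalyticAt ℝ d t₀ ∧
      ∀ᶠ t in 𝓝 t₀, (Q t).coeff j = (t - t₀) ^ (m * (k + 2 - j)) * d t := by
    intro j
    refine (hQ j).exists_eq_pow_mul_of_abs_le
      (C := M ^ (k + 2 - j : ℕ) * (k + 2).choose j) ?_
    filter_upwards [hVM, hr, h0] with t h1 h2 h3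
    refine (h2.splits.abs_coeff_le (hn t).1 (hn t).2 h3 (by positivity) h1 j).trans_eq ?_
    rw [mul_pow, ← pow_mul]
    ring
  choose d hda hd using hd
  -- Away from `t₀`, this is `Q` with its roots divided by `(t - t₀) ^ m`.
  set R : ℝ → ℝ[X] := fun t => monicPoly (k + 2) fun j => d j t
  have hR : AnalyticFamilyAt R t₀ := analyticAt_coeff_monicPoly (analyticAt_pi_iff.2 hda)
  have hRn : ∀ t, (R t).Monic ∧ (R t).natDegree = k + 2 := fun t =>
    ⟨monic_monicPoly _ _, natDegree_monicPoly _ _⟩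
  have hQR : ∀ᶠ t in 𝓝 t₀, Q t = (R t).scaleRoots ((t - t₀) ^ m) := by
    filter_upwards [eventually_all.2 hd] with t ht
    refine (hn t).1.eq_of_coeffVec_eq ((monic_scaleRoots_iff _).2 (hRn t).1) (hn t).2
      ((natDegree_scaleRoots _ _).trans (hRn t).2) ?_
    ext j
    rw [coeffVec_apply, coeffVec_apply, coeff_scaleRoots, (hRn t).2, coeff_monicPoly, ht j,
      ← pow_mul, mul_comm]
  have hRr : ∀ᶠ t in 𝓝 t₀, AllRootsReal (R t) := by
    have hpunct : ∀ᶠ t in 𝓝[≠] t₀, AllRootsReal (R t) := by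
      filter_upwards [nhdsWithin_le_nhds hQR, nhdsWithin_le_nhds hr, self_mem_nhdsWithin]
        with t h1 h2 h3
      exact AllRootsReal.of_scaleRoots (pow_ne_zero m (sub_ne_zero.2 h3)) (h1 ▸ h2)
    -- At `t₀` the scaling may degenerate, so real-rootedness comes from the limit.
    have hcenter := allRootsReal_of_eventually hR hRn hpunct
    filter_upwards [eventually_nhdsWithin_iff.1 hpunct] with t ht
    rcases eq_or_ne t t₀ with rfl | hne
    · exact hcenter
    · exact ht hne
  have hcoeff : ∀ j, j < k + 2 → ∀ᶠ t in 𝓝 t₀,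
      (Q t).coeff j = (t - t₀) ^ (m * (k + 2 - j)) * (R t).coeff j := by
    intro j hj
    filter_upwards [hd ⟨j, hj⟩] with t ht
    rw [ht, ← coeff_monicPoly (fun i => d i t) ⟨j, hj⟩]
  have hR1 : (R t₀).coeff (k + 1) = 0 := by
    refine eq_of_eventually_pow_mul_eq (f := fun t => (R t).coeff (k + 1))
      (k := m * (k + 2 - (k + 1))) (g := fun _ => 0)
      (hR (k + 1)).continuousAt continuousAt_const ?_
    filter_upwards [hcoeff (k + 1) (by omega), h0] with t h1 h2
    rw [← h1, h2, mul_zero]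
  -- The order of `V` is exactly `2m`, so this is nonzero and `R t₀` is not a pure power.
  have hR2 : (R t₀).coeff k = -(1 / 2) * g t₀ := by
    refine eq_of_eventually_pow_mul_eq (f := fun t => (R t).coeff k) (k := m * 2) (g := fun t => -(1 / 2) * g t)
      (hR k).continuousAt (continuousAt_const.mul hg.continuousAt) ?_
    filter_upwards [hcoeff k (by omega), hVg] with t h1 h2
    rw [Nat.add_sub_cancel_left] at h1
    rw [hm, ← mul_two] at h2
    rw [← h1]
    simp only [V] at h2
    linear_combination (-1 / 2) * h2
  have hroots : HasAnalyticRootsAt (k + 2) R t₀ := by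
    refine hasAnalyticRootsAt_of_not_pow ih hR hRn hRr (by omega) fun r hr => ?_
    rw [hr] at hR1 hR2
    rw [X_sub_C_pow_eq_of_coeff_eq_zero hR1] at hR2
    apply hg0
    linarith
  have hc : AnalyticAt ℝ (fun t => (t - t₀) ^ m) t₀ := by fun_prop
  exact (hroots.scaleRoots hc).congr hQR

/-- Rellich's theorem, local form: an analytic family of monic real-rooted polynomials has
analytic roots. -/
theorem analyticRootsInDegree (n : ℕ) (t₀ : ℝ) : AnalyticRootsInDegree n t₀ := by
  induction n using Nat.strong_induction_on with
  | _ n ih =>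
  intro P hP hn hr
  match n, ih, hn with
  | 0, _, hn =>
    exact ⟨fun _ _ => 0, fun _ => analyticAt_const, Eventually.of_forall fun t => by
      simpa using (hn t).1.natDegree_eq_zero.1 (hn t).2⟩
  | 1, _, hn =>
    refine ⟨fun _ t => -(P t).coeff 0, fun _ => (hP 0).neg, Eventually.of_forall fun t => ?_⟩
    simpa using (hn t).1.eq_X_add_C (hn t).2
  | k + 2, ih, hn =>
    -- Near `t₀` this is the mean of the roots.
    set c : ℝ → ℝ := fun t => -(P t).coeff (k + 1) / ((k + 1 : ℕ) + 1)
    have hc : AnalyticAt ℝ c t₀ := (hP (k + 1)).neg.div_const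
    refine HasAnalyticRootsAt.of_taylor hc ?_
    refine hasAnalyticRootsAt_of_centered ih (hP.taylor (fun t => (hn t).2) hc)
      (fun t => ⟨?_, (natDegree_taylor _ _).trans (hn t).2⟩) ?_ ?_
    · rw [Monic, leadingCoeff_taylor]
      exact (hn t).1
    · filter_upwards [hr] with t ht using ht.taylor _
    · filter_upwards [hr] with t ht
      rw [ht.splits.coeff_taylor (hn t).1 (hn t).2]
      simp only [c]
      have : ((k + 1 : ℕ) : ℝ) + 1 ≠ 0 := by positivity
      field_simp
      ring

/-! ### Uniqueness and gluing -/

lemma exists_perm_of_prod_X_sub_C_eq {n : ℕ} {x y : Fin n → ℝ}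
    (h : ∏ i, (X - C (x i)) = ∏ i, (X - C (y i))) : ∃ σ : Equiv.Perm (Fin n), ∀ i, y i = x (σ i) := by
  have hm : (Finset.univ.val.map x) = Finset.univ.val.map y := by
    have key : ∀ z : Fin n → ℝ, (∏ i, (X - C (z i))).roots = Finset.univ.val.map z := fun z => by
      rw [← roots_multiset_prod_X_sub_C (Finset.univ.val.map z), Multiset.map_map]
      rfl
    rw [← key, ← key, h]
  have hcard : ∀ c, Nonempty ({i // y i = c} ≃ {i // x i = c}) := fun c => by
    have h1 := congrArg (Multiset.count c) hm
    rw [Multiset.count_map, Multiset.count_map] at h1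
    refine Fintype.card_eq.1 ?_
    simp only [Fintype.card_subtype, eq_comm (b := c)]
    exact h1.symm
  exact ⟨Equiv.ofFiberEquiv fun c => (hcard c).some, fun i => (Equiv.ofFiberEquiv_map _ i).symm⟩

/-- The functions `x i` are analytic on `U` and are the roots of `P t` for `t ∈ U`. -/
structure IsAnalyticRootSystemOn {n : ℕ} (P : ℝ → ℝ[X]) (x : Fin n → ℝ → ℝ) (U : Set ℝ) :
    Prop where
  analytic : ∀ i, AnalyticOnNhd ℝ (x i) U
  factor : ∀ t ∈ U, P t = ∏ i, (X - C (x i t))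

namespace IsAnalyticRootSystemOn

variable {n : ℕ} {P : ℝ → ℝ[X]} {x y : Fin n → ℝ → ℝ} {U V : Set ℝ}

lemma mono (hx : IsAnalyticRootSystemOn P x U) (h : V ⊆ U) : IsAnalyticRootSystemOn P x V :=
  ⟨fun i => (hx.analytic i).mono h, fun t ht => hx.factor t (h ht)⟩

lemma perm (hx : IsAnalyticRootSystemOn P x U) (σ : Equiv.Perm (Fin n)) :
    IsAnalyticRootSystemOn P (fun i => x (σ i)) U :=
  ⟨fun i => hx.analytic (σ i), fun t ht => by
    rw [hx.factor t ht, Equiv.prod_comp σ fun i => X - C (x i t)]⟩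

lemma congr (hx : IsAnalyticRootSystemOn P x U) (hU : IsOpen U)
    (h : ∀ i, ∀ t ∈ U, x i t = y i t) : IsAnalyticRootSystemOn P y U :=
  ⟨fun i => (hx.analytic i).congr hU (h i), fun t ht => by simp only [hx.factor t ht, h _ t ht]⟩

lemma union (hU : IsAnalyticRootSystemOn P x U) (hV : IsAnalyticRootSystemOn P x V) :
    IsAnalyticRootSystemOn P x (U ∪ V) :=
  ⟨fun i t ht => ht.elim (hU.analytic i t) (hV.analytic i t),
    fun t ht => ht.elim (hU.factor t) (hV.factor t)⟩

/-- Two analytic systems of roots on a connected open set differ by a constant permutation. -/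
theorem exists_perm (hx : IsAnalyticRootSystemOn P x U) (hy : IsAnalyticRootSystemOn P y U)
    (hU : IsOpen U) (hc : IsPreconnected U) :
    ∃ σ : Equiv.Perm (Fin n), ∀ i, ∀ t ∈ U, y i t = x (σ i) t := by
  rcases U.eq_empty_or_nonempty with rfl | ⟨t₀, ht₀⟩
  · exact ⟨1, by simp⟩
  have h : ∃ᶠ t in 𝓝[≠] t₀, ∃ σ : Equiv.Perm (Fin n), ∀ i, y i t = x (σ i) t := by
    refine Eventually.frequently ?_
    filter_upwards [nhdsWithin_le_nhds (hU.mem_nhds ht₀)] with t ht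
    exact exists_perm_of_prod_X_sub_C_eq ((hx.factor t ht).symm.trans (hy.factor t ht))
  -- The permutation so far depends on `t`; as there are finitely many, a single one works for
  -- points accumulating at `t₀`.
  obtain ⟨σ, hσ⟩ := frequently_exists.1 h
  exact ⟨σ, fun i => (hy.analytic i).eqOn_of_preconnected_of_frequently_eq (hx.analytic (σ i)) hc
    ht₀ (hσ.mono fun t ht => ht i)⟩

/-- Analytic systems of roots on overlapping intervals can be glued. -/
lemma exists_union (hU : IsOpen U) (hV : IsOpen V) (hUV : IsPreconnected (U ∩ V))
    (hx : IsAnalyticRootSystemOn P x U) (hy : IsAnalyticRootSystemOn P y V) :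
    ∃ z : Fin n → ℝ → ℝ, IsAnalyticRootSystemOn P z (U ∪ V) := by
  classical
  obtain ⟨σ, hσ⟩ := (hy.mono Set.inter_subset_right).exists_perm (hx.mono Set.inter_subset_left)
    (hU.inter hV) hUV
  refine ⟨fun i t => if t ∈ U then x i t else y (σ i) t, union (hx.congr hU ?_)
    ((hy.perm σ).congr hV ?_)⟩
  · intro i t ht
    simp [ht]
  · intro i t ht
    by_cases h : t ∈ U
    · simp [h, hσ i t ⟨h, ht⟩]
    · simp [h]

end IsAnalyticRootSystemOn

/-! ### From local systems to the whole line -/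

lemma HasAnalyticRootsAt.exists_isAnalyticRootSystemOn {n : ℕ} {P : ℝ → ℝ[X]} {t₀ : ℝ}
    (h : HasAnalyticRootsAt n P t₀) :
    ∃ ε > 0, ∃ x : Fin n → ℝ → ℝ, IsAnalyticRootSystemOn P x (Set.Ioo (t₀ - ε) (t₀ + ε)) := by
  obtain ⟨x, hx, hP⟩ := h
  obtain ⟨ε, hε, h⟩ := Metric.eventually_nhds_iff_ball.1
    ((eventually_all.2 fun i => (hx i).eventually_analyticAt).and hP)
  rw [Real.ball_eq_Ioo] at h
  exact ⟨ε, hε, x, fun i t ht => (h t ht).1 i, fun t ht => (h t ht).2⟩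

lemma exists_isAnalyticRootSystemOn_Ioo {n : ℕ} {P : ℝ → ℝ[X]}
    (h : ∀ t, HasAnalyticRootsAt n P t) (T : ℝ) :
    ∃ x : Fin n → ℝ → ℝ, IsAnalyticRootSystemOn P x (Set.Ioo (-T) T) := by
  by_contra hT
  set S : Set ℝ := {T | ∃ x : Fin n → ℝ → ℝ, IsAnalyticRootSystemOn P x (Set.Ioo (-T) T)}
  have hlow : ∀ s ∈ S, ∀ r ≤ s, r ∈ S := fun s ⟨x, hx⟩ r hr =>
    ⟨x, hx.mono (Set.Ioo_subset_Ioo (neg_le_neg hr) hr)⟩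
  obtain ⟨δ, hδ, x₀, hx₀⟩ := (h 0).exists_isAnalyticRootSystemOn
  have hδS : δ ∈ S := ⟨x₀, by simpa using hx₀⟩
  have hbdd : BddAbove S := ⟨T, fun s hs => by
    by_contra! hlt
    exact hT (hlow s hs T hlt.le)⟩
  -- Gluing on local systems at `M` and `-M` passes beyond the supremum.
  set M := sSup S
  have hM : 0 < M := hδ.trans_le (le_csSup hbdd hδS)
  obtain ⟨ε₁, hε₁, y, hy⟩ := (h M).exists_isAnalyticRootSystemOn
  obtain ⟨ε₂, hε₂, z, hz⟩ := (h (-M)).exists_isAnalyticRootSystemOn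
  set ε := min (min ε₁ ε₂) M
  have hε : 0 < ε := lt_min (lt_min hε₁ hε₂) hM
  have h1 : ε ≤ ε₁ := (min_le_left _ _).trans (min_le_left _ _)
  have h2 : ε ≤ ε₂ := (min_le_left _ _).trans (min_le_right _ _)
  have h3 : ε ≤ M := min_le_right _ _
  obtain ⟨s, ⟨x, hx⟩, hs⟩ := exists_lt_of_lt_csSup ⟨δ, hδS⟩ (show M - ε < M by linarith)
  have hsM : s ≤ M := le_csSup hbdd ⟨x, hx⟩
  obtain ⟨w, hw⟩ := IsAnalyticRootSystemOn.exists_union isOpen_Ioo isOpen_Ioo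
    (by rw [Set.Ioo_inter_Ioo]; exact isPreconnected_Ioo) hx hy
  have hw' : IsAnalyticRootSystemOn P w (Set.Ioo (-s) (M + ε)) := by
    refine hw.mono fun t ht => ?_
    rcases lt_or_ge t s with hts | hts
    · exact Or.inl ⟨ht.1, hts⟩
    · exact Or.inr ⟨by linarith, by linarith [ht.2]⟩
  obtain ⟨v, hv⟩ := IsAnalyticRootSystemOn.exists_union isOpen_Ioo isOpen_Ioo
    (by rw [Set.Ioo_inter_Ioo]; exact isPreconnected_Ioo) hz hw'
  have hv' : M + ε ∈ S := by
    refine ⟨v, hv.mono fun t ht => ?_⟩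
    rcases lt_or_ge (-s) t with hts | hts
    · exact Or.inr ⟨hts, ht.2⟩
    · exact Or.inl ⟨by linarith [ht.1], by linarith⟩
  linarith [le_csSup hbdd hv']

theorem exists_isAnalyticRootSystemOn_univ {n : ℕ} {P : ℝ → ℝ[X]}
    (h : ∀ t, HasAnalyticRootsAt n P t) :
    ∃ x : Fin n → ℝ → ℝ, IsAnalyticRootSystemOn P x Set.univ := by
  choose y hy using fun k : ℕ => exists_isAnalyticRootSystemOn_Ioo h (k + 1)
  have hsub : ∀ {k l : ℕ}, k ≤ l →
      Set.Ioo (-((k : ℝ) + 1)) (k + 1) ⊆ Set.Ioo (-((l : ℝ) + 1)) (l + 1) := fun {k l} hkl => by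
    have : (k : ℝ) ≤ l := Nat.cast_le.2 hkl
    exact Set.Ioo_subset_Ioo (by linarith) (by linarith)
  -- Reorder every system to agree with the first on `(-1, 1)`; the identity theorem then makes them
  -- all compatible.
  choose σ hσ using fun k : ℕ => ((hy k).mono (hsub k.zero_le)).exists_perm (hy 0) isOpen_Ioo
    isPreconnected_Ioo
  set z : ℕ → Fin n → ℝ → ℝ := fun k i => y k (σ k i)
  have hz : ∀ k : ℕ, IsAnalyticRootSystemOn P (z k) (Set.Ioo (-((k : ℝ) + 1)) (k + 1)) :=
    fun k => (hy k).perm (σ k)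
  have hmono : ∀ {k l : ℕ}, k ≤ l → ∀ i, ∀ t ∈ Set.Ioo (-((k : ℝ) + 1)) (k + 1),
      z k i t = z l i t := by
    intro k l hkl i
    refine ((hz k).analytic i).eqOn_of_preconnected_of_eventuallyEq
      (((hz l).analytic i).mono (hsub hkl)) isPreconnected_Ioo (z₀ := 0)
      ⟨by linarith [k.cast_nonneg (α := ℝ)], by linarith [k.cast_nonneg (α := ℝ)]⟩ ?_
    filter_upwards [isOpen_Ioo.mem_nhds
      (show (0 : ℝ) ∈ Set.Ioo (-(((0 : ℕ) : ℝ) + 1)) ((0 : ℕ) + 1) by simp)] with t ht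
    exact (hσ k i t ht).symm.trans (hσ l i t ht)
  have hmem : ∀ t : ℝ, t ∈ Set.Ioo (-((⌈|t|⌉₊ : ℝ) + 1)) (⌈|t|⌉₊ + 1) := fun t =>
    abs_lt.1 ((Nat.le_ceil |t|).trans_lt (lt_add_one _))
  set x : Fin n → ℝ → ℝ := fun i t => z ⌈|t|⌉₊ i t
  have hx : ∀ k : ℕ, IsAnalyticRootSystemOn P x (Set.Ioo (-((k : ℝ) + 1)) (k + 1)) := by
    refine fun k => (hz k).congr isOpen_Ioo fun i t ht => ?_
    rcases le_total k ⌈|t|⌉₊ with hk | hk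
    · exact hmono hk i t ht
    · exact (hmono hk i t (hmem t)).symm
  exact ⟨x, fun i t _ => (hx _).analytic i t (hmem t), fun t _ => (hx _).factor t (hmem t)⟩

/-! ### Application to `polyCurve` -/

lemma degree_polyCurve_tail_lt (n : ℕ) (a : ℕ → ℝ → ℝ) (t : ℝ) :
    (∑ i ∈ Finset.Icc 1 n, C ((-1) ^ i * a i t) * X ^ (n - i) : ℝ[X]).degree < (n : WithBot ℕ) := by
  refine (degree_sum_le _ _).trans_lt ((Finset.sup_lt_iff (WithBot.bot_lt_coe (α := ℕ) n)).2 fun i hi => ?_)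
  refine (degree_C_mul_X_pow_le _ _).trans_lt ?_
  have := Finset.mem_Icc.1 hi
  exact WithBot.coe_lt_coe.2 (show n - i < n by omega)

lemma polyCurve_monic_natDegree (n : ℕ) (a : ℕ → ℝ → ℝ) (t : ℝ) :
    (polyCurve n a t).Monic ∧ (polyCurve n a t).natDegree = n := by
  refine ⟨monic_X_pow_add (degree_polyCurve_tail_lt n a t), ?_⟩
  apply natDegree_eq_of_degree_eq_some
  rw [polyCurve, degree_add_eq_left_of_degree_lt] <;> simp [degree_polyCurve_tail_lt, -map_mul]

lemma analyticFamilyAt_polyCurve {n : ℕ} {a : ℕ → ℝ → ℝ}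
    (ha : ∀ i ∈ Finset.Icc 1 n, AnalyticOnNhd ℝ (a i) Set.univ) (t₀ : ℝ) :
    AnalyticFamilyAt (polyCurve n a) t₀ := by
  intro k
  simp only [polyCurve, coeff_add, finsetSum_coeff, coeff_C_mul]
  exact analyticAt_const.add <| Finset.analyticAt_fun_sum _ fun i hi =>
    (analyticAt_const.mul (ha i hi t₀ (Set.mem_univ _))).mul analyticAt_const

theorem mainTheorem3 (n : ℕ) (a : ℕ → ℝ → ℝ)
    (ha : ∀ i ∈ Finset.Icc 1 n, AnalyticOnNhd ℝ (a i) Set.univ)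
    (hreal : ∀ t : ℝ, AllRootsReal (polyCurve n a t)) :
    (∃ x : Fin n → ℝ → ℝ, IsAnalyticRootSystem (polyCurve n a) x) ∧
    (∀ x y : Fin n → ℝ → ℝ,
      IsAnalyticRootSystem (polyCurve n a) x → IsAnalyticRootSystem (polyCurve n a) y →
        ∃ σ : Equiv.Perm (Fin n), ∀ (i : Fin n) (t : ℝ), y i t = x (σ i) t) := by
  refine ⟨?_, fun x y hx hy => ?_⟩
  · obtain ⟨x, hx⟩ := exists_isAnalyticRootSystemOn_univ fun t => analyticRootsInDegree n t
      (polyCurve n a) (analyticFamilyAt_polyCurve ha t) (polyCurve_monic_natDegree n a)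
      (Eventually.of_forall hreal)
    exact ⟨x, hx.analytic, fun t => hx.factor t (Set.mem_univ t)⟩
  · have hx' : IsAnalyticRootSystemOn (polyCurve n a) x Set.univ :=
      ⟨hx.analytic, fun t _ => hx.factor t⟩
    have hy' : IsAnalyticRootSystemOn (polyCurve n a) y Set.univ :=
      ⟨hy.analytic, fun t _ => hy.factor t⟩
    obtain ⟨σ, hσ⟩ := hx'.exists_perm hy' isOpen_univ isPreconnected_univ
    exact ⟨σ, fun i t => hσ i t (Set.mem_univ t)⟩
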